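/- Let $\mathcal{A}$ be a finite set of action symbols, let $\tau\notin\mathcal{A}$ denote the unobservable action, and put $\mathcal{A}_\tau=\mathcal{A}\cup\{\tau\}$. A transition system is a quadruple $T=(S,\to,\uparrow,\downarrow)$ with a set of states $S$, a relation ${\to}\subseteq S\times\mathcal{A}_\tau\times S$, an initial state ${\uparrow}\in S$ and a set of final states ${\downarrow}\subseteq S$. Put $\mathit{out}(s)=\{(a,t)\mid s\xrightarrow{a}t\}$ and let $\mathit{fin}$ be the characteristic function of $\downarrow$. $T$ is boundedly branching if there is $B\in\mathbb{N}$ with $|\mathit{out}(s)|\le B$ for all $s\in S$. $T$ is computable if every $\mathit{out}(s)$ is finite and, for some injective codings of $\mathcal{A}_\tau$ and $S$ into $\mathbb{N}$, the partial functions $\mathbb{N}\rightharpoonup\mathbb{N}$ that map the code of a state $s$ to the code of $\mathit{out}(s)$ and to $\mathit{fin}(s)$, respectively, and that are undefined on numbers that are not codes of states, are partial recursive (pairs and finite sets of natural numbers being coded in the standard way). A reactive Turing machine (RTM) over a finite set $\mathcal{D}$ of data symbols, with blank $\Box\notin\mathcal{D}$ and $\mathcal{D}_\Box=\mathcal{D}\cup\{\Box\}$,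 consists of a finite set of states $Q$, an initial state, a set of final states, and a transition relation contained in $Q\times\mathcal{D}_\Box\times\mathcal{A}_\tau\times\mathcal{D}_\Box\times\{L,R\}\times Q$. Its transition system has as states the configurations (a state together with a two-way infinite tape with all but finitely many cells blank and a head position); an RTM-transition $(q,d,a,e,M,q')$ induces an $a$-labelled transition from each configuration with state $q$ and $d$ under the head to the configuration with state $q'$ in which $d$ has been replaced by $e$ and the head has moved one cell in direction $M$; the initial configuration is the initial state with the blank tape, and a configuration is final iff its state is. Write $\twoheadrightarrow$ and $\to^+$ for the reflexive-transitive and the transitive closure of $\xrightarrow{\tau}$, and $s\xrightarrow{(a)}t$ if $s\xrightarrow{a}t$, or $a=\tau$ and $s=t$. Transition systems $T_1,T_2$ are divergence-preserving branching bisimilar if there is a relation $R\subseteq S_1\times S_2$ that relates their initial states and is such that $s_1\mathrel{R}s_2$ implies the following conditions and their symmetric counterparts, with the roles of $T_1$ and $T_2$ exchanged: (i) if $s_1\xrightarrow{a}s_1'$, then there are $s_2'',s_2'$ with $s_2\twoheadrightarrow s_2''\xrightarrow{(a)}s_2'$, $s_1\mathrel{R}s_2''$ and $s_1'\mathrel{R}s_2'$;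 (ii) if $s_1$ is final, then there is a final $s_2'$ with $s_2\twoheadrightarrow s_2'$ and $s_1\mathrel{R}s_2'$; (iii) if $s_1=s_{1,0}\xrightarrow{\tau}s_{1,1}\xrightarrow{\tau}\cdots$ is an infinite sequence with $s_{1,i}\mathrel{R}s_2$ for all $i$, then there are $s_2'$ and $i$ with $s_2\to^+s_2'$ and $s_{1,i}\mathrel{R}s_2'$. Theorem. For every finite set $\mathcal{A}$ there is a finite set $\mathcal{D}$ of data symbols such that every boundedly branching computable transition system with labels in $\mathcal{A}_\tau$ is divergence-preserving branching bisimilar to the transition system associated with some RTM with action symbols $\mathcal{A}$ and data symbols $\mathcal{D}$. -/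

import Mathlib

universe u v w

namespace ReactiveTM

/-- The set `A ∪ {τ}` of actions: `some a` is the observable action `a`, and `none` is the
unobservable action `τ`. -/
abbrev Act (A : Type u) : Type u := Option A

/-- The unobservable action. -/
abbrev tau {A : Type u} : Act A := none

/-- The tape symbols `D ∪ {□}`: `some d` is the data symbol `d`, and `none` is the blank `□`. -/
abbrev TapeSymbol (D : Type u) : Type u := Option D

/-- A transition system with state set `S`, labelled by actions from `A ∪ {τ}`. -/
structure TransitionSystem (A : Type u) (S : Type v) where
  step : S → Act A → S → Prop
  init : S
  final : Set S

namespace TransitionSystem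

variable {A : Type u} {S : Type v} {S' : Type w}

/-- The set of outgoing transitions of a state. -/
def out (T : TransitionSystem A S) (s : S) : Set (Act A × S) :=
  {p | T.step s p.1 p.2}

open Classical in
/-- The characteristic function of the set of final states. -/
noncomputable def fin (T : TransitionSystem A S) (s : S) : ℕ :=
  if s ∈ T.final then 1 else 0

/-- The branching degree is bounded by `B`. -/
def BranchingDegreeBoundedBy (T : TransitionSystem A S) (B : ℕ) : Prop :=
  ∀ s, (T.out s).encard ≤ B

def BoundedlyBranching (T : TransitionSystem A S) : Prop :=
  ∃ B : ℕ, T.BranchingDegreeBoundedBy B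

def FinitelyBranching (T : TransitionSystem A S) : Prop :=
  ∀ s, (T.out s).Finite

/-- The canonical index `∑ 2 ^ n` (`n ∈ X`) of a finite set `X` of natural numbers. -/
def canonicalIndex (X : Finset ℕ) : ℕ := ∑ n ∈ X, 2 ^ n

/-- A finitely branching transition system is computable if, for some codings (injections into `ℕ`)
of actions and states, the functions `out` and `fin` are recursive. On natural numbers, these
are partial functions, defined precisely on the codes of states; a transition is coded as the pair
of the codes of its action and its target, a finite set of transitions by the canonical
index of the set of their codes. -/
def IsComputable (T : TransitionSystem A S) : Prop :=
  ∃ hfin : T.FinitelyBranching,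
  ∃ (codeAct : Act A → ℕ) (codeState : S → ℕ),
    Function.Injective codeAct ∧ Function.Injective codeState ∧
    ∃ outN finN : ℕ →. ℕ,
      Partrec outN ∧ Partrec finN ∧
      (∀ s, outN (codeState s) = Part.some (canonicalIndex
        ((hfin s).toFinset.image fun p => Nat.pair (codeAct p.1) (codeState p.2)))) ∧
      (∀ s, finN (codeState s) = Part.some (T.fin s)) ∧
      (∀ n, n ∉ Set.range codeState → outN n = Part.none ∧ finN n = Part.none)

/-- A single `τ`-transition. -/
def TauStep (T : TransitionSystem A S) (s t : S) : Prop := T.step s tau t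

/-- Zero or more `τ`-transitions. -/
def TauSteps (T : TransitionSystem A S) : S → S → Prop := Relation.ReflTransGen T.TauStep

/-- One or more `τ`-transitions. -/
def TauStepsPlus (T : TransitionSystem A S) : S → S → Prop := Relation.TransGen T.TauStep

/-- A transition labelled `a`, which may be omitted if `a = τ`. -/
def OptStep (T : TransitionSystem A S) (s : S) (a : Act A) (t : S) : Prop :=
  T.step s a t ∨ (a = tau ∧ s = t)

structure IsBranchingBisimulation (T₁ : TransitionSystem A S) (T₂ : TransitionSystem A S')
    (R : S → S' → Prop) : Prop where
  step_left : ∀ s₁ s₂, R s₁ s₂ → ∀ a s₁', T₁.step s₁ a s₁' →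
    ∃ s₂'' s₂', T₂.TauSteps s₂ s₂'' ∧ T₂.OptStep s₂'' a s₂' ∧ R s₁ s₂'' ∧ R s₁' s₂'
  step_right : ∀ s₁ s₂, R s₁ s₂ → ∀ a s₂', T₂.step s₂ a s₂' →
    ∃ s₁'' s₁', T₁.TauSteps s₁ s₁'' ∧ T₁.OptStep s₁'' a s₁' ∧ R s₁'' s₂ ∧ R s₁' s₂'
  final_left : ∀ s₁ s₂, R s₁ s₂ → s₁ ∈ T₁.final →
    ∃ s₂', T₂.TauSteps s₂ s₂' ∧ R s₁ s₂' ∧ s₂' ∈ T₂.final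
  final_right : ∀ s₁ s₂, R s₁ s₂ → s₂ ∈ T₂.final →
    ∃ s₁', T₁.TauSteps s₁ s₁' ∧ R s₁' s₂ ∧ s₁' ∈ T₁.final

structure IsDivergencePreservingBranchingBisimulation
    (T₁ : TransitionSystem A S) (T₂ : TransitionSystem A S') (R : S → S' → Prop) : Prop
    extends IsBranchingBisimulation T₁ T₂ R where
  divergence_left : ∀ s₁ s₂, R s₁ s₂ → ∀ σ : ℕ → S, σ 0 = s₁ →
    (∀ i, T₁.TauStep (σ i) (σ (i + 1))) → (∀ i, R (σ i) s₂) →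
    ∃ s₂', T₂.TauStepsPlus s₂ s₂' ∧ ∃ i, R (σ i) s₂'
  divergence_right : ∀ s₁ s₂, R s₁ s₂ → ∀ σ : ℕ → S', σ 0 = s₂ →
    (∀ i, T₂.TauStep (σ i) (σ (i + 1))) → (∀ i, R s₁ (σ i)) →
    ∃ s₁', T₁.TauStepsPlus s₁ s₁' ∧ ∃ i, R s₁' (σ i)

/-- Divergence-preserving branching bisimilarity. -/
def DPBranchingBisimilar (T₁ : TransitionSystem A S) (T₂ : TransitionSystem A S') : Prop :=
  ∃ R : S → S' → Prop,
    IsDivergencePreservingBranchingBisimulation T₁ T₂ R ∧ R T₁.init T₂.init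

end TransitionSystem

/-- A reactive Turing machine with action symbols `A` and data symbols `D`. A tuple
`(s, d, a, e, M, t)` in `trans` is the transition that, in state `s` with `d` under the head,
executes `a`, writes `e`, moves the head in direction `M`, and ends up in state `t`. -/
structure RTM (A : Type u) (D : Type v) where
  State : Type
  finite_state : Finite State
  trans : Set (State × TapeSymbol D × Act A × TapeSymbol D × Turing.Dir × State)
  init : State
  final : Set State

namespace RTM

variable {A : Type u} {D : Type v}

/-- A configuration: a state and a tape instance, i.e. a two-way infinite tape with all but finitely
many cells blank, and a marked head position. -/
abbrev Config (M : RTM A D) : Type v := M.State × Turing.Tape (TapeSymbol D)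

/-- The blank tape. -/
def blankTape (D : Type v) : Turing.Tape (TapeSymbol D) :=
  { head := none, left := default, right := default }

/-- The transition system associated with a reactive Turing machine. -/
def lts (M : RTM A D) : TransitionSystem A M.Config where
  step c a c' := ∃ (e : TapeSymbol D) (m : Turing.Dir),
    (c.1, c.2.head, a, e, m, c'.1) ∈ M.trans ∧ c'.2 = (c.2.write e).move m
  init := (M.init, blankTape D)
  final := {c | c.1 ∈ M.final}

end RTM

end ReactiveTM

/-! The machine keeps the code of the current state `s` on its tape and a bit vector, the menu of
`s`, in its control. The menu records whether `s` is final and, for each position `i` below the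
branching bound and each action `a`, whether the `i`-th transition of `s` has label `a`. Bounded
branching makes it finite, so a single configuration can offer all transitions of `s`. Choosing one
starts a deterministic `τ`-computation of the code and the menu of the target.

Relate `s` to each configuration whose deterministic run ends at the menu of `s`. Deterministic
steps stay related to `s`, and runs terminate, so no divergence is introduced:
`isDivergencePreservingBranchingBisimulation_of_eval`.

The runs evaluate `ToPartrec.Code`s by a stack machine over a fixed alphabet, reduced to a one-tape
machine in `exists_machine`. Different systems change only the control, so one alphabet serves them
all. `exists_rtm` assembles the RTM, and `exists_rtm_of_isComputable` provides the codes. -/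

namespace ReactiveTM

open Relation StateTransition

/-! ### Bisimilarity from terminating deterministic runs. -/

namespace TransitionSystem

variable {A : Type u} {S : Type v} {C : Type w}

/-- `Menu s c` is meant to say that the halted configuration `c` offers exactly the transitions
of the state `s`: then every configuration evaluating to such a `c` is bisimilar to `s`. -/
theorem isDivergencePreservingBranchingBisimulation_of_eval
    (T : TransitionSystem A S) (U : TransitionSystem A C) (f : C → Option C)
    (Menu : S → C → Prop)
    (step_iff : ∀ c c', f c = some c' → ∀ a c'', U.step c a c'' ↔ a = tau ∧ c'' = c')
    (not_final : ∀ c c', f c = some c' → c ∉ U.final)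
    (menu_halted : ∀ s c, Menu s c → f c = none)
    (menu_final : ∀ s c, Menu s c → (c ∈ U.final ↔ s ∈ T.final))
    (menu_left : ∀ s c, Menu s c → ∀ a t, T.step s a t →
      ∃ c', U.step c a c' ∧ ∃ d ∈ eval f c', Menu t d)
    (menu_right : ∀ s c, Menu s c → ∀ a c', U.step c a c' →
      ∃ t, T.step s a t ∧ ∃ d ∈ eval f c', Menu t d) :
    IsDivergencePreservingBranchingBisimulation T U (fun s c => ∃ d ∈ eval f c, Menu s d) := by
  have self_mem : ∀ s d, Menu s d → d ∈ eval f d := fun s d h =>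
    mem_eval.2 ⟨ReflTransGen.refl, menu_halted s d h⟩
  have tauSteps : ∀ c d, d ∈ eval f c → U.TauSteps c d := fun c d h =>
    (mem_eval.1 h).1.lift id fun a b hab => (step_iff a b hab tau b).2 ⟨rfl, rfl⟩
  have eq_of_halted : ∀ c d, d ∈ eval f c → f c = none → c = d := fun c d h hc =>
    Part.mem_unique (mem_eval.2 ⟨ReflTransGen.refl, hc⟩) h
  have eval_step : ∀ c c', f c = some c' → eval f c = eval f c' := fun c c' h =>
    reaches_eval (ReflTransGen.single h)
  refine { step_left := ?_, step_right := ?_, final_left := ?_, final_right := ?_,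
           divergence_left := ?_, divergence_right := ?_ }
  · rintro s c ⟨d, hd, hm⟩ a t hst
    obtain ⟨c', hc', hR⟩ := menu_left s d hm a t hst
    exact ⟨d, c', tauSteps c d hd, Or.inl hc', ⟨d, self_mem s d hm, hm⟩, hR⟩
  · rintro s c ⟨d, hd, hm⟩ a c' hcc
    cases hf : f c with
    | none =>
      obtain rfl := eq_of_halted c d hd hf
      obtain ⟨t, ht, hR⟩ := menu_right s c hm a c' hcc
      exact ⟨s, t, ReflTransGen.refl, Or.inl ht, ⟨c, hd, hm⟩, hR⟩
    | some b =>
      obtain ⟨rfl, rfl⟩ := (step_iff c b hf a c').1 hcc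
      exact ⟨s, s, ReflTransGen.refl, Or.inr ⟨rfl, rfl⟩, ⟨d, hd, hm⟩,
        ⟨d, eval_step c _ hf ▸ hd, hm⟩⟩
  · rintro s c ⟨d, hd, hm⟩ hs
    exact ⟨d, tauSteps c d hd, ⟨d, self_mem s d hm, hm⟩, (menu_final s d hm).2 hs⟩
  · rintro s c ⟨d, hd, hm⟩ hc
    cases hf : f c with
    | none =>
      obtain rfl := eq_of_halted c d hd hf
      exact ⟨s, ReflTransGen.refl, ⟨c, hd, hm⟩, (menu_final s c hm).1 hc⟩
    | some b => exact absurd hc (not_final c b hf)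
  · rintro s c ⟨d, hd, hm⟩ σ rfl hσ -
    -- The first `τ`-step is enough: a menu choice is a genuine step of `U`, so the matching path is
    -- nonempty.
    obtain ⟨c', hc', hR⟩ := menu_left _ d hm tau _ (hσ 0)
    exact ⟨c', TransGen.tail' (tauSteps c d hd) hc', 1, hR⟩
  · rintro s c ⟨d, hd, -⟩ σ rfl hσ hR
    -- An infinite `τ`-path follows the terminating run until it halts; its next step is a menu
    -- choice, which a genuine `τ`-step from `s` matches.
    have halts : ∃ i, f (σ i) = none := by
      have key : ∀ c, d ∈ eval f c → ∀ i, σ i = c → ∃ j, f (σ j) = none := by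
        intro c hc
        refine evalInduction hc fun c _ ih i hi => ?_
        cases hf : f c with
        | none => exact ⟨i, hi ▸ hf⟩
        | some b =>
          refine ih b hf (i + 1) ?_
          exact ((step_iff (σ i) b (hi ▸ hf) tau _).1 (hσ i)).2
      exact key (σ 0) hd 0 rfl
    obtain ⟨i, hi⟩ := halts
    obtain ⟨e, he, hm⟩ := hR i
    obtain rfl := eq_of_halted _ _ he hi
    obtain ⟨t, ht, hRt⟩ := menu_right s _ hm tau _ (hσ i)
    exact ⟨t, TransGen.single ht, i + 1, hRt⟩

end TransitionSystem

end ReactiveTM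

/-! ### From finitely many codes to one finite Post–Turing machine. -/

namespace ReactiveTM

open Relation StateTransition Turing

section Epilogue

variable {K : Type*} {Γ : K → Type*} {Λ σ X : Type*}

/-- Adds a component `X` to the internal state of a stack machine statement, and executes `e`
where the statement would halt. -/
def withEpilogue (e : TM2.Stmt Γ Λ (σ × X)) : TM2.Stmt Γ Λ σ → TM2.Stmt Γ Λ (σ × X)
  | .push k f q => .push k (fun s => f s.1) (withEpilogue e q)
  | .peek k f q => .peek k (fun s a => (f s.1 a, s.2)) (withEpilogue e q)
  | .pop k f q => .pop k (fun s a => (f s.1 a, s.2)) (withEpilogue e q)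
  | .load f q => .load (fun s => (f s.1, s.2)) (withEpilogue e q)
  | .branch p q₁ q₂ => .branch (fun s => p s.1) (withEpilogue e q₁) (withEpilogue e q₂)
  | .goto l => .goto fun s => l s.1
  | .halt => e

/-- The configuration of the machine with epilogue `e` that corresponds to a configuration of the
original machine. -/
def epilogueCfg [DecidableEq K] (e : TM2.Stmt Γ Λ (σ × X)) (x : X) : TM2.Cfg Γ Λ σ → TM2.Cfg Γ Λ (σ × X)
  | ⟨some l, v, S⟩ => ⟨some l, (v, x), S⟩
  | ⟨none, v, S⟩ => TM2.stepAux e (v, x) S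

theorem stepAux_withEpilogue [DecidableEq K] (e : TM2.Stmt Γ Λ (σ × X)) (x : X) (q : TM2.Stmt Γ Λ σ) (v : σ)
    (S : ∀ k, List (Γ k)) :
    TM2.stepAux (withEpilogue e q) (v, x) S = epilogueCfg e x (TM2.stepAux q v S) := by
  induction q generalizing v S with
  | push k f q ih => exact ih _ _
  | peek k f q ih => exact ih _ _
  | pop k f q ih => exact ih _ _
  | load f q ih => exact ih _ _
  | branch p q₁ q₂ ih₁ ih₂ =>
    simp only [withEpilogue, TM2.stepAux]
    cases p v <;> simp [ih₁, ih₂]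
  | goto l => rfl
  | halt => rfl

/-- The epilogue runs within the step that would halt, so steps correspond one to one; `he` makes
the images of halted configurations halted. -/
theorem withEpilogue_respects [DecidableEq K] (e : TM2.Stmt Γ Λ (σ × X)) (x : X)
    (he : ∀ v S, (TM2.stepAux e v S).l = none) (M : Λ → TM2.Stmt Γ Λ σ) :
    Respects (TM2.step M) (TM2.step fun l => withEpilogue e (M l))
      fun a b => epilogueCfg e x a = b := by
  refine fun_respects.2 ?_
  rintro ⟨_ | l, v, S⟩
  · simp only [TM2.step, FRespects, epilogueCfg]
    have h := he (v, x) S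
    revert h
    rcases TM2.stepAux e (v, x) S with ⟨_ | l, v', S'⟩ <;> simp
  · refine TransGen.single ?_
    simp [epilogueCfg, stepAux_withEpilogue]

theorem supportsStmt_withEpilogue {e : TM2.Stmt Γ Λ (σ × X)} {S : Finset Λ}
    (he : TM2.SupportsStmt S e) {q : TM2.Stmt Γ Λ σ} (hq : TM2.SupportsStmt S q) :
    TM2.SupportsStmt S (withEpilogue e q) := by
  induction q with
  | push k f q ih => exact ih hq
  | peek k f q ih => exact ih hq
  | pop k f q ih => exact ih hq
  | load f q ih => exact ih hq
  | branch p q₁ q₂ ih₁ ih₂ => exact ⟨ih₁ hq.1, ih₂ hq.2⟩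
  | goto l => exact fun v => hq v.1
  | halt => exact he

end Epilogue

section ReadBits

open PartrecToTM2

variable {X : Type*}

/-- Pops `k` numbers, each `0` or `1`, from the main stack and stores them, together with the bits
`acc` read before, in the internal state. -/
def readBits (g : List Bool → X) :
    ℕ → List Bool → TM2.Stmt (fun _ : K' => PartrecToTM2.Γ') PartrecToTM2.Λ'
      (Option PartrecToTM2.Γ' × X)
  | 0, acc => .load (fun _ => (none, g acc)) .halt
  | k + 1, acc =>
    .pop K'.main (fun s a => (a, s.2)) <|
      .branch (fun s => s.1 = some .cons) (readBits g k (acc ++ [false])) <|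
        .pop K'.main (fun s a => (a, s.2)) (readBits g k (acc ++ [true]))

theorem stepAux_readBits_l (g : List Bool → X) (k : ℕ) (acc : List Bool) (s) (S) :
    (TM2.stepAux (readBits g k acc) s S).l = none := by
  induction k generalizing acc s S with
  | zero => rfl
  | succ k ih =>
    simp only [readBits, TM2.stepAux]
    rw [Bool.cond_decide]
    split_ifs <;> exact ih _ _ _

/-- On the stack, `0` is just the separator `cons`, while `1` is `bit1` followed by `cons`; hence
the second pop for a `1` only. -/
theorem stepAux_readBits (g : List Bool → X) (bits acc : List Bool) (w : List ℕ) (s) :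
    TM2.stepAux (readBits g bits.length acc) s
        (K'.elim (trList (bits.map Bool.toNat ++ w)) [] [] []) =
      ⟨none, (none, g (acc ++ bits)), K'.elim (trList w) [] [] []⟩ := by
  have h1 : trNat 1 = [.bit1] := rfl
  induction bits generalizing acc s with
  | nil => simp [readBits]
  | cons b bits ih =>
    cases b <;> simp [readBits, h1, ih]

theorem supportsStmt_readBits (g : List Bool → X) (k : ℕ) (acc : List Bool) (S) :
    TM2.SupportsStmt S (readBits g k acc) := by
  induction k generalizing acc with
  | zero => trivial
  | succ k ih => exact ⟨ih _, ih _⟩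

end ReadBits

/-- The alphabet of the tapes that hold the four stacks of the machine evaluating codes. -/
abbrev StackAlphabet : Type := TM2to1.Γ' PartrecToTM2.K' fun _ => PartrecToTM2.Γ'

instance : Finite PartrecToTM2.K' :=
  Set.finite_univ_iff.1 <| (Set.toFinite {.main, .rev, .aux, .stack}).subset fun k _ => by
    cases k <;> simp

instance : Finite StackAlphabet :=
  inferInstanceAs (Finite (Bool × (PartrecToTM2.K' → Option PartrecToTM2.Γ')))

open PartrecToTM2 in
/-- The tape `T` represents the main stack holding the list `v`, the other stacks being empty. -/
def Represents (v : List ℕ) (T : Tape StackAlphabet) : Prop :=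
  ∃ L : ListBlank (K' → Option PartrecToTM2.Γ'),
    (∀ k, L.map (proj k) = ListBlank.mk ((K'.elim (trList v) [] [] [] k).map some).reverse) ∧
      T = Tape.mk' ∅ (TM2to1.addBottom L)

/-- The symbol that marks the bottom of the stacks. -/
def bottomSymbol : StackAlphabet := (true, fun _ => none)

theorem represents_nil : Represents [] ((default : Tape StackAlphabet).write bottomSymbol) := by
  refine ⟨default, fun k => ?_, rfl⟩
  cases k <;> rfl

section Machine

open PartrecToTM2

variable {ι : Type} (K : ℕ)

/-- The stack machine that evaluates codes, modified to move the first `K` numbers of the result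
into the internal state. -/
def codeMachine : PartrecToTM2.Λ' → TM2.Stmt (fun _ : K' => PartrecToTM2.Γ') PartrecToTM2.Λ'
    (Option PartrecToTM2.Γ' × (Fin K → Bool)) :=
  fun l => withEpilogue (readBits (fun bits j => bits.getD j false) K []) (tr l)

theorem codeMachine_eval (c : ToPartrec.Code) (v w : List ℕ) (x : Fin K → Bool)
    (h : List.ofFn (fun j => (x j).toNat) ++ w ∈ c.eval v) :
    (⟨none, (none, x), K'.elim (trList w) [] [] []⟩ : TM2.Cfg _ _ _) ∈
      eval (TM2.step (codeMachine K))
        ⟨some (trNormal c Cont'.halt), (none, default), K'.elim (trList v) [] [] []⟩ := by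
  have h₁ : PartrecToTM2.halt (List.ofFn (fun j => (x j).toNat) ++ w) ∈
      eval (TM2.step tr) (PartrecToTM2.init c v) := by
    rw [PartrecToTM2.tr_eval]
    exact (Part.mem_map_iff _).2 ⟨_, h, rfl⟩
  obtain ⟨b, hb, h₂⟩ := StateTransition.tr_eval
    (withEpilogue_respects (readBits (fun bits (j : Fin K) => bits.getD j false) K []) default
      (fun _ _ => stepAux_readBits_l _ _ _ _ _) tr) rfl h₁
  have h₃ := stepAux_readBits (fun bits (j : Fin K) => bits.getD j false) (List.ofFn x) [] w
    (none, default)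
  rw [List.length_ofFn, List.map_ofFn] at h₃
  have hx : (fun j : Fin K => ([] ++ List.ofFn x).getD j false) = x := by
    funext j
    simp
  rw [hx] at h₃
  exact (hb.symm.trans h₃) ▸ h₂

/-- One machine runs all the codes, which differ only in their start states. The bits of the result
end up in the halting state, where the control of an RTM can act on them; the rest `w` stays on the
tape as the next input. -/
theorem exists_machine [Finite ι] (code : ι → ToPartrec.Code) :
    ∃ (Q : Type) (_ : Finite Q) (_ : Inhabited Q) (M : TM0.Machine StackAlphabet Q)
      (start : ι → Q) (halted : (Fin K → Bool) → Q), Function.Injective halted ∧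
      (∀ x a, M (halted x) a = none) ∧
      ∀ i v x w T, Represents v T →
        List.ofFn (fun j => (x j).toNat) ++ w ∈ (code i).eval v →
        ∃ T', Represents w T' ∧ ⟨halted x, T'⟩ ∈ eval (TM0.step M) ⟨start i, T⟩ := by
  classical
  have := Fintype.ofFinite ι
  let N := TM2to1.tr (codeMachine K)
  let M₀ := TM1to0.tr N
  let S : Finset PartrecToTM2.Λ' :=
    insert default (Finset.univ.biUnion fun i => codeSupp (code i) Cont'.halt)
  have codeSupp_subset : ∀ i, codeSupp (code i) Cont'.halt ⊆ S := fun i =>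
    (Finset.subset_biUnion_of_mem (fun i => codeSupp (code i) Cont'.halt)
      (Finset.mem_univ i)).trans (Finset.subset_insert _ _)
  have supp₂ : TM2.Supports (codeMachine K) S := by
    refine ⟨Finset.mem_insert_self _ _, fun q hq => ?_⟩
    refine supportsStmt_withEpilogue (supportsStmt_readBits _ _ _ _) ?_
    rcases Finset.mem_insert.1 hq with rfl | hq
    · trivial
    · obtain ⟨i, -, hi⟩ := Finset.mem_biUnion.1 hq
      exact codeSupp_supports (codeSupp_subset i) q hi
  have supp₁ := TM2to1.tr_supports (codeMachine K) supp₂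
  have supp₀ := TM1to0.tr_supports N supp₁
  let S₀ := TM1to0.trStmts N (TM2to1.trSupp (codeMachine K) S)
  let start : ι → TM1to0.Λ' N := fun i =>
    (some (N (.normal (trNormal (code i) Cont'.halt))), (none, default))
  have start_mem : ∀ i, start i ∈ S₀ := by
    intro i
    refine Finset.mem_product.2 ⟨Finset.some_mem_insertNone.2 (Finset.mem_biUnion.2
      ⟨_, Finset.mem_biUnion.2 ⟨_, codeSupp_subset i (codeSupp_self _ _ (trStmts₁_self _)),
        Finset.mem_insert_self _ _⟩, TM1.stmts₁_self⟩), Finset.mem_univ _⟩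
  -- A `TM1to0` state contains the internal variable, so it still holds the bits after halting.
  let halted : (Fin K → Bool) → TM1to0.Λ' N := fun x => (none, (none, x))
  have halted_mem : ∀ x, halted x ∈ S₀ := fun x =>
    Finset.mem_product.2 ⟨Finset.none_mem_insertNone, Finset.mem_univ _⟩
  -- The supporting set `S₀` is closed under transitions, so `M₀` restricts to a machine with
  -- finitely many states.
  have restrict : ∀ (q : S₀) (a : StackAlphabet), ∃ o : Option (S₀ × TM0.Stmt StackAlphabet),
      o.map (Prod.map Subtype.val id) = M₀ q a := by
    intro q a
    rcases h : M₀ q a with _ | ⟨q', s⟩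
    · exact ⟨none, rfl⟩
    · exact ⟨some (⟨q', supp₀.2 h q.2⟩, s), rfl⟩
  choose M hM using restrict
  let : Inhabited S₀ := ⟨⟨default, supp₀.1⟩⟩
  refine ⟨S₀, inferInstance, inferInstance, M, fun i => ⟨start i, start_mem i⟩,
    fun x => ⟨halted x, halted_mem x⟩, ?_, ?_, ?_⟩
  · intro x y h
    have h' : ((none, (none, x)) : TM1to0.Λ' N) = (none, (none, y)) := congrArg Subtype.val h
    exact congrArg (fun q : TM1to0.Λ' N => q.2.2) h'
  · intro x a
    have h := hM ⟨halted x, halted_mem x⟩ a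
    exact Option.map_eq_none_iff.1 h
  · rintro i v x w T ⟨L, hL, rfl⟩ h
    have h₂ := codeMachine_eval K (code i) v w x h
    obtain ⟨b, ⟨L', hL'⟩, h₁⟩ := StateTransition.tr_eval (TM2to1.tr_respects (codeMachine K))
      (TM2to1.TrCfg.mk L hL) h₂
    obtain ⟨b, rfl, h₀⟩ := StateTransition.tr_eval (TM1to0.tr_respects N) rfl h₁
    refine ⟨_, ⟨L', hL', rfl⟩, ?_⟩
    let lift : TM0.Cfg StackAlphabet S₀ → TM0.Cfg StackAlphabet (TM1to0.Λ' N) :=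
      fun c => ⟨c.q, c.Tape⟩
    have resp : Respects (TM0.step M) (TM0.step M₀) fun a b => lift a = b := by
      refine fun_respects.2 ?_
      rintro ⟨q, T⟩
      have h := hM q T.head
      rcases h' : M q T.head with _ | ⟨q', s⟩ <;> rw [h'] at h
      · simp [TM0.step, h', FRespects, lift, ← h]
      · simp only [TM0.step, h', FRespects]
        refine TransGen.single ?_
        simp [TM0.step, lift, ← h]
    obtain ⟨c, hc, h₃⟩ := StateTransition.tr_eval_rev resp 
      (a₁ := ⟨⟨start i, start_mem i⟩, Tape.mk' ∅ (TM2to1.addBottom L)⟩) rfl h₀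
    have hc' : c = ⟨⟨halted x, halted_mem x⟩, Tape.mk' ∅ (TM2to1.addBottom L')⟩ := by
      rcases c with ⟨⟨q, hq⟩, T⟩
      cases hc
      rfl
    exact hc' ▸ h₃

end Machine

end ReactiveTM

/-! ### Simulation of a Post–Turing machine by an RTM. -/

namespace ReactiveTM

open Relation StateTransition Turing

/-- The states of a reactive Turing machine simulating a Post–Turing machine with states `Q`: in
`boot` the machine initializes the tape, in `run q` it simulates the state `q`, and in `back q` it
moves left and enters `run q`. -/
inductive SimState (Q : Type) : Type
  | boot : SimState Q
  | run : Q → SimState Q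
  | back : Q → SimState Q

instance {Q : Type} [Finite Q] : Finite (SimState Q) := by
  refine Finite.of_surjective (α := Option (Q ⊕ Q))
    (fun o => o.elim .boot (Sum.elim .run .back)) ?_
  rintro (_ | q | q)
  exacts [⟨none, rfl⟩, ⟨some (.inl q), rfl⟩, ⟨some (.inr q), rfl⟩]

section Simulation

variable {A : Type u} {D Q Γ : Type} [Inhabited Q] (e : Option D ≃ Γ)
  (M : TM0.Machine Γ Q) (mark : Γ) (q₀ : Q) (choice : Q → Act A → Q → Prop)

/-- The transitions of the reactive Turing machine that writes `mark`, simulates `M` from state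
`q₀`, and may perform `a` and continue with state `q'` from state `q` if `choice q a q'`. -/
inductive SimTrans :
    SimState Q → TapeSymbol D → Act A → TapeSymbol D → Dir → SimState Q → Prop
  | boot (d) : SimTrans .boot d tau (e.symm mark) .right (.back q₀)
  | back (q d) : SimTrans (.back q) d tau d .left (.run q)
  | move (q d q' m) (h : M q (e d) = some (q', .move m)) : SimTrans (.run q) d tau d m (.run q')
  | write (q d q' g) (h : M q (e d) = some (q', .write g)) :
      SimTrans (.run q) d tau (e.symm g) .right (.back q')
  | choose (q d a q') (h : choice q a q') : SimTrans (.run q) d a d .right (.back q')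

/-- The reactive Turing machine with transitions `SimTrans`. -/
def simRTM [Finite Q] (final : Set Q) : RTM A D where
  State := SimState Q
  finite_state := inferInstance
  trans := {t | SimTrans e M mark q₀ choice t.1 t.2.1 t.2.2.1 t.2.2.2.1 t.2.2.2.2.1 t.2.2.2.2.2}
  init := .boot
  final := SimState.run '' final

/-- The deterministic part of the behaviour of `simRTM`. -/
def simStep : SimState Q × Tape (TapeSymbol D) → Option (SimState Q × Tape (TapeSymbol D))
  | (.boot, T) => some (.back q₀, (T.write (e.symm mark)).move .right)
  | (.back q, T) => some (.run q, T.move .left)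
  | (.run q, T) => (M q (e T.head)).map fun p =>
    match p.2 with
    | .move m => (.run p.1, T.move m)
    | .write g => (.back p.1, (T.write (e.symm g)).move .right)

/-- Choices exist only where `M` has no instruction, so they never compete with a deterministic
step. -/
theorem simRTM_step_iff [Finite Q] (final : Set Q)
    (choice_halted : ∀ q a q', choice q a q' → ∀ g, M q g = none)
    (c c' : SimState Q × Tape (TapeSymbol D)) (hc : simStep e M mark q₀ c = some c')
    (a : Act A) (c'' : SimState Q × Tape (TapeSymbol D)) :
    (simRTM e M mark q₀ choice final).lts.step c a c'' ↔ a = tau ∧ c'' = c' := by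
  rcases c with ⟨q, T⟩
  rcases c'' with ⟨q'', T''⟩
  constructor
  · rintro ⟨d, m, h, hT⟩
    dsimp only at hT
    subst hT
    change SimTrans e M mark q₀ choice q T.head a d m q'' at h
    cases h with
    | boot => exact ⟨rfl, Option.some_inj.1 hc⟩
    | back q =>
      rw [Tape.write_self]
      exact ⟨rfl, Option.some_inj.1 hc⟩
    | move q _ q' m h =>
      simp only [simStep, h, Option.map_some, Option.some.injEq] at hc
      rw [Tape.write_self]
      exact ⟨rfl, hc⟩
    | write q _ q' g h =>
      simp only [simStep, h, Option.map_some, Option.some.injEq] at hc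
      exact ⟨rfl, hc⟩
    | choose q _ a q' h =>
      simp [simStep, choice_halted q a _ h] at hc
  · rintro ⟨rfl, rfl⟩
    cases q with
    | boot =>
      cases hc
      exact ⟨_, _, SimTrans.boot _, rfl⟩
    | back q =>
      cases hc
      exact ⟨_, _, SimTrans.back _ _, by rw [Tape.write_self]⟩
    | run q =>
      obtain ⟨⟨q', _ | g⟩, hp, h⟩ := Option.map_eq_some_iff.1 hc
      · cases h
        exact ⟨_, _, SimTrans.move _ _ _ _ hp, by rw [Tape.write_self]⟩
      · cases h
        exact ⟨_, _, SimTrans.write _ _ _ _ hp, rfl⟩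

theorem simRTM_step_run_iff [Finite Q] (final : Set Q) (q : Q) (hq : ∀ g, M q g = none)
    (T : Tape (TapeSymbol D)) (a : Act A) (c : SimState Q × Tape (TapeSymbol D)) :
    (simRTM e M mark q₀ choice final).lts.step (SimState.run q, T) a c ↔
      ∃ q', choice q a q' ∧ c = (.back q', T.move .right) := by
  constructor
  · rcases c with ⟨q'', T''⟩
    rintro ⟨d, m, h, hT⟩
    dsimp only at hT
    subst hT
    change SimTrans e M mark q₀ choice (.run q) T.head a d m q'' at h
    cases h with
    | move _ _ _ _ h => simp [hq] at h
    | write _ _ _ _ h => simp [hq] at h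
    | choose _ _ _ q' h => exact ⟨q', h, by rw [Tape.write_self]⟩
  · rintro ⟨q', h, rfl⟩
    exact ⟨_, _, SimTrans.choose _ _ a q' h, by rw [Tape.write_self]⟩

/-- The inverse of the bijection `e` as a map of tape alphabets. -/
def symmMap [Inhabited Γ] (he : e none = default) : PointedMap Γ (TapeSymbol D) :=
  ⟨e.symm, by rw [← he, e.symm_apply_apply]; rfl⟩

/-- A Post–Turing write leaves the head in place, but every RTM-transition moves it: a write becomes
a step right and, through `back`, a step left. -/
theorem simStep_respects [Inhabited Γ] (he : e none = default) :
    Respects (TM0.step M) (simStep e M mark q₀)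
      fun a b => (SimState.run a.q, a.Tape.map (symmMap e he)) = b := by
  refine fun_respects.2 ?_
  rintro ⟨q, T⟩
  have head : e ((symmMap e he).f T.head) = T.head := e.apply_symm_apply _
  rcases h : M q T.head with _ | ⟨q', m | g⟩
  · simp [TM0.step, h, FRespects, simStep, head]
  · simp only [TM0.step, h, Option.map_some, FRespects]
    refine TransGen.single ?_
    simp [simStep, head, h, Tape.map_move]
  · simp only [TM0.step, h, Option.map_some, FRespects]
    refine TransGen.tail (b := (.back q', ((T.write g).map (symmMap e he)).move .right))
      (TransGen.single ?_) ?_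
    · simp only [simStep, Tape.map_fst, head, h, Option.map_some, Option.mem_def, Tape.map_write]
      rfl
    · simp [simStep]

theorem eval_simStep_back (q : Q) (T : Tape (TapeSymbol D)) :
    eval (simStep e M mark q₀) (.back q, T.move .right) =
      eval (simStep e M mark q₀) (.run q, T) :=
  reaches_eval (ReflTransGen.single (by simp [simStep]))

end Simulation

/-! ### The RTM assembled from codes and menus. -/

/-- The data symbols: all symbols of the tapes holding stacks but the blank. -/
abbrev StackData : Type := {g : StackAlphabet // g ≠ default}

/-- A transition system is bisimilar to a reactive Turing machine if the passage from a state to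
its successors, and the finite description `menu` of the outgoing transitions of each state, are
computed by finitely many codes. -/
theorem exists_rtm {A : Type u} {S : Type v} (T : TransitionSystem A S) {ι : Type} [Finite ι]
    (code : ι → ToPartrec.Code) {K : ℕ} (choice : (Fin K → Bool) → Act A → ι → Prop)
    (final : Set (Fin K → Bool)) (i₀ : ι) (codeState : S → ℕ) (menu : S → Fin K → Bool)
    (hinit : List.ofFn (fun j => (menu T.init j).toNat) ++ [codeState T.init] ∈
      (code i₀).eval [])
    (hfinal : ∀ s, menu s ∈ final ↔ s ∈ T.final)
    (hleft : ∀ s a t, T.step s a t → ∃ i, choice (menu s) a i ∧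
      List.ofFn (fun j => (menu t j).toNat) ++ [codeState t] ∈ (code i).eval [codeState s])
    (hright : ∀ s a i, choice (menu s) a i → ∃ t, T.step s a t ∧
      List.ofFn (fun j => (menu t j).toNat) ++ [codeState t] ∈ (code i).eval [codeState s]) :
    ∃ M : RTM A StackData, T.DPBranchingBisimilar M.lts := by
  classical
  obtain ⟨Q, _, _, M, start, halted, halted_inj, M_halted, M_eval⟩ := exists_machine K code
  let e : Option StackData ≃ StackAlphabet := Equiv.optionSubtypeNe default
  have he : e none = default := Equiv.optionSubtypeNe_none _
  let chc : Q → Act A → Q → Prop := fun q a q' =>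
    ∃ x i, q = halted x ∧ choice x a i ∧ q' = start i
  let R : RTM A StackData := simRTM e M bottomSymbol (start i₀) chc (halted '' final)
  let f := simStep e M bottomSymbol (start i₀)
  let Menu : S → SimState Q × Tape (TapeSymbol StackData) → Prop := fun s c =>
    ∃ U, Represents [codeState s] U ∧ c = (.run (halted (menu s)), U.map (symmMap e he))
  have eval_start : ∀ i v U t, Represents v U →
      List.ofFn (fun j => (menu t j).toNat) ++ [codeState t] ∈ (code i).eval v →
      ∃ d ∈ eval f (.back (start i), (U.map (symmMap e he)).move .right), Menu t d := by
    intro i v U t hU h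
    obtain ⟨U', hU', h₁⟩ := M_eval i v _ _ U hU h
    obtain ⟨d, rfl, hd⟩ := tr_eval (simStep_respects e M bottomSymbol (start i₀) he) rfl h₁
    refine ⟨_, ?_, U', hU', rfl⟩
    rw [eval_simStep_back]
    exact hd
  refine ⟨R, _, T.isDivergencePreservingBranchingBisimulation_of_eval R.lts f Menu
    ?_ ?_ ?_ ?_ ?_ ?_, ?_⟩
  · refine simRTM_step_iff e M bottomSymbol (start i₀) chc (halted '' final) ?_
    rintro _ a _ ⟨x, i, rfl, -⟩ g
    exact M_halted x g
  · rintro ⟨_, U⟩ c' hc ⟨_, ⟨x, -, rfl⟩, rfl⟩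
    simp [f, simStep, M_halted] at hc
  · rintro s _ ⟨U, -, rfl⟩
    simp only [f, simStep, M_halted]
    rfl
  · rintro s _ ⟨U, -, rfl⟩
    rw [← hfinal]
    constructor
    · rintro ⟨_, ⟨x, hx, rfl⟩, h⟩
      rwa [← halted_inj (SimState.run.inj h)]
    · exact fun h => ⟨_, ⟨_, h, rfl⟩, rfl⟩
  · rintro s _ ⟨U, hU, rfl⟩ a t hst
    obtain ⟨i, hi, h⟩ := hleft s a t hst
    exact ⟨_, (simRTM_step_run_iff e M _ _ chc _ _ (M_halted _) _ a _).2
      ⟨start i, ⟨_, i, rfl, hi, rfl⟩, rfl⟩, eval_start i _ U t hU h⟩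
  · rintro s _ ⟨U, hU, rfl⟩ a c hc
    obtain ⟨_, ⟨x, i, hx, hi, rfl⟩, rfl⟩ :=
      (simRTM_step_run_iff e M _ _ chc _ _ (M_halted _) _ a c).1 hc
    obtain rfl := halted_inj hx
    obtain ⟨t, ht, h⟩ := hright s a i hi
    exact ⟨t, ht, eval_start i _ U t hU h⟩
  · obtain ⟨d, hd, hm⟩ := eval_start i₀ [] _ T.init represents_nil hinit
    refine ⟨d, ?_, hm⟩
    have blank : (default : Tape StackAlphabet).map (symmMap e he) = RTM.blankTape StackData := by
      have h : symmMap e he default = none := (symmMap e he).map_pt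
      change Tape.mk _ _ _ = Tape.mk _ _ _
      congr 1
    rw [Tape.map_write, blank] at hd
    -- A lone bottom marker already represents the empty list, so one write prepares the input of
    -- the initial code.
    have boot : eval f (SimState.boot, RTM.blankTape StackData) = eval f (.back (start i₀),
        ((RTM.blankTape StackData).write (e.symm bottomSymbol)).move .right) :=
      reaches_eval (ReflTransGen.single rfl)
    exact boot ▸ hd

end ReactiveTM

/-! ### Codes that compute menus and successors. -/

namespace ReactiveTM

open Turing

/-- The elements of the finite set with canonical index `e`. -/
def indexMembers (e : ℕ) : List ℕ :=
  (List.range e).filterMap fun k => if e / 2 ^ k % 2 = 1 then some k else none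

theorem primrec_indexMembers : Primrec indexMembers := by
  refine Primrec.listFilterMap Primrec.list_range ?_
  have pow : Primrec₂ ((· ^ ·) : ℕ → ℕ → ℕ) := Primrec₂.unpaired'.1 Nat.Primrec.pow
  refine Primrec.ite (Primrec.eq.comp (Primrec.nat_mod.comp (Primrec.nat_div.comp Primrec.fst
    (pow.comp (Primrec.const 2) Primrec.snd)) (Primrec.const 2)) (Primrec.const 1)) ?_ ?_
  · exact Primrec.option_some.comp Primrec.snd
  · exact Primrec.const none

theorem indexMembers_eq_filter (e : ℕ) :
    indexMembers e = (List.range e).filter fun k => e.testBit k := by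
  rw [indexMembers, ← List.filterMap_eq_filter]
  refine List.filterMap_congr fun k _ => ?_
  simp [Option.guard, Nat.testBit_eq_decide_div_mod_eq]

theorem mem_indexMembers (X : Finset ℕ) (k : ℕ) :
    k ∈ indexMembers (TransitionSystem.canonicalIndex X) ↔ k ∈ X := by
  have h : (TransitionSystem.canonicalIndex X).testBit k ↔ k ∈ X := by
    rw [← Nat.mem_bitIndices, ← List.mem_toFinset, TransitionSystem.canonicalIndex,
      Finset.toFinset_bitIndices_sum_two_pow]
  rw [indexMembers_eq_filter, List.mem_filter, List.mem_range, h, and_iff_right_iff_imp]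
  -- Searching below `e` loses no member, as `k < 2 ^ k ≤ e` for each member `k`.
  exact fun hk => k.lt_two_pow_self.trans_le
    (Finset.single_le_sum (f := fun n => 2 ^ n) (fun _ _ => Nat.zero_le _) hk)

theorem length_indexMembers (X : Finset ℕ) :
    (indexMembers (TransitionSystem.canonicalIndex X)).length = X.card := by
  have nodup : (indexMembers (TransitionSystem.canonicalIndex X)).Nodup := by
    rw [indexMembers_eq_filter]
    exact List.nodup_range.filter _
  rw [← List.toFinset_card_of_nodup nodup]
  congr 1
  ext k
  rw [List.mem_toFinset, mem_indexMembers]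

theorem exists_code_of_partrec {f : ℕ →. ℕ} (hf : Partrec f) :
    ∃ c : ToPartrec.Code, ∀ n m, m ∈ f n → c.eval [n] = Part.some [m] := by
  obtain ⟨c, hc⟩ := ToPartrec.Code.exists_code (Nat.Partrec'.part_iff₁.2 hf)
  refine ⟨c, fun n m h => ?_⟩
  refine (hc ⟨[n], rfl⟩).trans ?_
  rw [show f (List.Vector.head ⟨[n], rfl⟩) = Part.some m from Part.eq_some_iff.2 h]
  exact Part.map_some _ _

theorem exists_code_const (n : ℕ) : ∃ c : ToPartrec.Code, c.eval [] = Part.some [n] := by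
  obtain ⟨c, hc⟩ := ToPartrec.Code.exists_code
    (Nat.Partrec'.of_prim (n := 0) (Primrec.const n))
  exact ⟨c, (hc ⟨[], rfl⟩).trans (Part.map_some _ _)⟩

/-- Ending the fold in `id` keeps the input behind the computed values: the state code remains on
the tape once the menu bits are popped. -/
theorem foldr_cons_eval (v : List ℕ) {K : ℕ} (c : Fin K → ToPartrec.Code) (x : Fin K → ℕ)
    (h : ∀ j, (c j).eval v = Part.some [x j]) :
    ((List.ofFn c).foldr ToPartrec.Code.cons ToPartrec.Code.id).eval v =
      Part.some (List.ofFn x ++ v) := by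
  induction K with
  | zero => simp
  | succ K ih =>
    rw [List.ofFn_succ, List.foldr_cons, ToPartrec.Code.cons_eval]
    simp only [h, ih (fun j => c j.succ) (fun j => x j.succ) fun j => h j.succ,
      Part.bind_eq_bind, Part.bind_some, Part.pure_eq_some, List.ofFn_succ]
    rfl

theorem TransitionSystem.exists_rtm_of_isComputable {A : Type u} [Finite A] {S : Type v}
    (T : TransitionSystem A S) (hT : T.IsComputable) (hB : T.BoundedlyBranching) :
    ∃ M : RTM A StackData, T.DPBranchingBisimilar M.lts := by
  classical
  obtain ⟨hfin, codeAct, codeState, codeAct_inj, codeState_inj, outN, finN, out_partrec,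
    fin_partrec, out_eq, fin_eq, -⟩ := hT
  obtain ⟨B, hB⟩ := hB
  -- The index `none` carries the finality bit, and `some (i, a)` the bit for label `a` at position
  -- `i`.
  obtain ⟨K, ⟨ε⟩⟩ := Finite.exists_equiv_fin (Option (Fin B × Act A))
  let X : S → Finset ℕ := fun s =>
    (hfin s).toFinset.image fun p => Nat.pair (codeAct p.1) (codeState p.2)
  let l : S → List ℕ := fun s => indexMembers (TransitionSystem.canonicalIndex (X s))
  have mem_l : ∀ s p, p ∈ l s ↔ ∃ a t, T.step s a t ∧ Nat.pair (codeAct a) (codeState t) = p := by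
    intro s p
    rw [mem_indexMembers]
    simp [X, TransitionSystem.out]
  have length_l : ∀ s, (l s).length ≤ B := by
    intro s
    rw [length_indexMembers]
    refine Finset.card_image_le.trans ?_
    have h := hB s
    rw [(hfin s).encard_eq_coe_toFinset_card] at h
    exact_mod_cast h
  -- Positions past the end of the list give `none`, hence offer nothing.
  let offers : ℕ → Act A → List ℕ → Prop := fun i a L =>
    L[i]?.map (fun p => p.unpair.1) = some (codeAct a)
  let menu : S → Fin K → Bool := fun s j =>
    (ε.symm j).elim (decide (s ∈ T.final)) fun p => decide (offers p.1 p.2 (l s))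
  have bitCode : ∀ j, ∃ c : ToPartrec.Code, ∀ s,
      c.eval [codeState s] = Part.some [(menu s j).toNat] := by
    intro j
    rcases hj : ε.symm j with _ | ⟨i, a⟩
    · obtain ⟨c, hc⟩ := exists_code_of_partrec fin_partrec
      refine ⟨c, fun s => hc _ _ ?_⟩
      rw [fin_eq]
      simp [menu, hj, TransitionSystem.fin, Bool.toNat, Bool.cond_decide]
    · have prim : Primrec fun L : List ℕ => if offers i a L then 1 else 0 := by
        refine Primrec.ite (Primrec.eq.comp (Primrec.option_map
          (Primrec.list_getElem?.comp Primrec.id (Primrec.const _))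
          (Primrec.fst.comp (Primrec.unpair.comp Primrec.snd)).to₂) (Primrec.const _))
          (Primrec.const 1) (Primrec.const 0)
      obtain ⟨c, hc⟩ := exists_code_of_partrec
        (out_partrec.map ((prim.comp primrec_indexMembers).to_comp.comp Computable.snd).to₂)
      refine ⟨c, fun s => hc _ _ ?_⟩
      rw [out_eq]
      simp [menu, hj, Bool.toNat, Bool.cond_decide, l, X]
  choose bit hbit using bitCode
  have succCode : ∀ i : Fin B, ∃ c : ToPartrec.Code, ∀ s p, (l s)[(i : ℕ)]? = some p →
      c.eval [codeState s] = Part.some [p.unpair.2] := by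
    intro i
    -- The default `0` is never relevant: the menu offers only positions that occur in the list.
    have prim : Primrec fun L : List ℕ => (L[(i : ℕ)]?.getD 0).unpair.2 :=
      Primrec.snd.comp (Primrec.unpair.comp (Primrec.option_getD.comp
        (Primrec.list_getElem?.comp Primrec.id (Primrec.const _)) (Primrec.const _)))
    obtain ⟨c, hc⟩ := exists_code_of_partrec
      (out_partrec.map ((prim.comp primrec_indexMembers).to_comp.comp Computable.snd).to₂)
    refine ⟨c, fun s p hp => hc _ _ ?_⟩
    rw [out_eq]
    refine (Part.mem_map_iff _).2 ⟨_, Part.mem_some _, ?_⟩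
    change ((l s)[(i : ℕ)]?.getD 0).unpair.2 = _
    rw [hp]
    rfl
  choose succ hsucc using succCode
  obtain ⟨initCode, hinitCode⟩ := exists_code_const (codeState T.init)
  let menuCode : ToPartrec.Code := (List.ofFn bit).foldr .cons .id
  have menuCode_eval : ∀ s, menuCode.eval [codeState s] =
      Part.some (List.ofFn (fun j => (menu s j).toNat) ++ [codeState s]) :=
    fun s => foldr_cons_eval _ _ _ fun j => hbit j s
  -- Each code finds a state (the initial one, or the `i`-th successor) and then prefixes its menu.
  let code : Option (Fin B) → ToPartrec.Code := fun o =>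
    menuCode.comp (o.elim initCode succ)
  have code_eval : ∀ o v t, (o.elim initCode succ).eval v = Part.some [codeState t] →
      List.ofFn (fun j => (menu t j).toNat) ++ [codeState t] ∈ (code o).eval v := by
    intro o v t h
    simp only [code, ToPartrec.Code.comp_eval, h]
    exact Part.mem_bind (Part.mem_some _) (menuCode_eval t ▸ Part.mem_some _)
  refine exists_rtm T code (fun x a o => ∃ i, o = some i ∧ x (ε (some (i, a))) = true)
    {x | x (ε none) = true} none codeState menu (code_eval none _ _ hinitCode) ?_ ?_ ?_
  · intro s
    simp [menu]
  · intro s a t hst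
    obtain ⟨i, hi, hp⟩ := List.mem_iff_getElem.1 ((mem_l s _).2 ⟨a, t, hst, rfl⟩)
    have hp' : (l s)[i]? = some (Nat.pair (codeAct a) (codeState t)) :=
      List.getElem?_eq_some_iff.2 ⟨hi, hp⟩
    let i' : Fin B := ⟨i, hi.trans_le (length_l s)⟩
    refine ⟨some i', ⟨i', rfl, ?_⟩, code_eval _ _ _ ?_⟩
    · simp [menu, offers, i', hp']
    · simpa using hsucc i' s _ hp'
  · rintro s a _ ⟨i, rfl, hi⟩
    have hoffers : offers i a (l s) := by simpa [menu] using hi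
    obtain ⟨p, hp, hpa⟩ := Option.map_eq_some_iff.1 hoffers
    obtain ⟨a', t, hst, rfl⟩ := (mem_l s p).1 (List.mem_of_getElem? hp)
    -- The menu compares codes of actions, so injectivity of the coding is what recovers the label.
    obtain rfl : a' = a := codeAct_inj (by simpa using hpa)
    exact ⟨t, hst, code_eval _ _ _ (by simpa using hsucc i s _ hp)⟩

end ReactiveTM

theorem mainTheorem1 (A : Type u) [Finite A] :
    ∃ (D : Type) (_ : Finite D),
      ∀ (S : Type v) (T : ReactiveTM.TransitionSystem A S),
        T.IsComputable → T.BoundedlyBranching →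
          ∃ M : ReactiveTM.RTM A D, T.DPBranchingBisimilar M.lts :=
  ⟨ReactiveTM.StackData, inferInstance, fun _ T hT hB => T.exists_rtm_of_isComputable hT hB⟩
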